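/- Let $G$ be an abelian lattice ordered group with identity $e$, written multiplicatively, and let $P=\{p\in G: p\ge e\}$ be its positive cone. Let $A$ be a $C^*$-algebra (not necessarily unital) and let $\alpha:P\to\operatorname{End}(A)$, $p\mapsto\alpha_p$, be a semigroup homomorphism into the $*$-endomorphisms of $A$, so that $\alpha_{st}=\alpha_s\circ\alpha_t$ for all $s,t\in P$; that is, $(A,\alpha,P)$ is a $C^*$-dynamical system. A representation of $P$ on a Hilbert space $\mathcal H$ is a map $T:P\to B(\mathcal H)$ with $T(e)=I$ and $T(st)=T(s)T(t)$. It is contractive (isometric) if every $T(p)$ is a contraction (an isometry), and Nica-covariant if $T(s)T(t)^*=T(t)^*T(s)$ whenever $s\wedge t=e$. A covariant pair $(\pi,T)$ on $\mathcal H$ consists of a $*$-representation $\pi:A\to B(\mathcal H)$ (a $*$-homomorphism, possibly degenerate) and a contractive representation $T$ of $P$ on $\mathcal H$ such that $\pi(a)T(s)=T(s)\pi(\alpha_s(a))$ for all $a\in A$, $s\in P$. The pair is called Nica-covariant (isometric) if $T$ is. A minimal isometric dilation of $T$ is an isometric representation $V:P\to B(\mathcal K)$ on a Hilbert space $\mathcal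 K\supseteq\mathcal H$ with $P_{\mathcal H}V(p)|_{\mathcal H}=T(p)$ for all $p\in P$ and $\mathcal K=\bigvee_{p\in P}V(p)\mathcal H$. It is regular if moreover $P_{\mathcal H}V(p)^*V(q)|_{\mathcal H}=T(p)^*T(q)$ for all $p,q\in P$ with $p\wedge q=e$. **Theorem 7.3.** Let $(\pi,T)$ be a Nica-covariant pair on $\mathcal H$ for $(A,\alpha,P)$. Then $T$ has a regular minimal isometric dilation. Moreover, for every regular minimal isometric dilation $V:P\to B(\mathcal K)$ of $T$ there is a $*$-representation $\rho:A\to B(\mathcal K)$ such that $(\rho,V)$ is an isometric Nica-covariant pair for $(A,\alpha,P)$, such that $P_{\mathcal H}\rho(a)|_{\mathcal H}=\pi(a)$ for all $a\in A$, and such that $\mathcal H$ is invariant for $\rho(a)$ for all $a\in A$. -/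

import Mathlib

/-!  Covariant pairs over the positive cone of an abelian lattice ordered group, and isometric
dilations of contractive representations.

The group `G` is written multiplicatively, and its positive cone `P` is
`Submonoid.oneLE G`, that is, the submonoid of all `p` with `1 ≤ p`.  A representation of `P` on a
Hilbert space `H` is a monoid homomorphism from `P` to the bounded operators on `H`. -/

universe u v w x

section Pairs

variable {G : Type u} [CommGroup G] [Lattice G] [IsOrderedMonoid G]
variable {A : Type v} [NonUnitalCStarAlgebra A]
variable {H : Type w} [NormedAddCommGroup H] [InnerProductSpace ℂ H] [CompleteSpace H]

/-- `T(s) T(t)* = T(t)* T(s)` whenever `s ∧ t = e`. -/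
def IsNicaCovariant (T : Submonoid.oneLE G →* (H →L[ℂ] H)) : Prop :=
  ∀ s t : Submonoid.oneLE G, (s : G) ⊓ (t : G) = 1 → T s * star (T t) = star (T t) * T s

/-- A covariant pair `(π, T)` for the C*-dynamical system `(A, α, P)`: a *-representation `π` of `A`
(possibly degenerate) and a contractive representation `T` of `P` on the same Hilbert space, with
`π(a) T(s) = T(s) π(α_s(a))`. -/
structure IsCovariantPair (α : Submonoid.oneLE G →ₙ* (A →⋆ₙₐ[ℂ] A))
    (π : A →⋆ₙₐ[ℂ] (H →L[ℂ] H)) (T : Submonoid.oneLE G →* (H →L[ℂ] H)) : Prop where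
  contractive : ∀ s, ‖T s‖ ≤ 1
  covariant : ∀ s a, π a * T s = T s * π (α s a)

/-- A covariant pair `(π, T)` in which `T` is Nica-covariant. -/
structure IsNicaCovariantPair (α : Submonoid.oneLE G →ₙ* (A →⋆ₙₐ[ℂ] A))
    (π : A →⋆ₙₐ[ℂ] (H →L[ℂ] H)) (T : Submonoid.oneLE G →* (H →L[ℂ] H)) : Prop
    extends IsCovariantPair α π T where
  nica : IsNicaCovariant T

/-- A covariant pair `(π, T)` in which `T` is both isometric and Nica-covariant. -/
structure IsIsometricNicaCovariantPair (α : Submonoid.oneLE G →ₙ* (A →⋆ₙₐ[ℂ] A))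
    (π : A →⋆ₙₐ[ℂ] (H →L[ℂ] H)) (T : Submonoid.oneLE G →* (H →L[ℂ] H)) : Prop
    extends IsNicaCovariantPair α π T where
  isometric : ∀ s, Isometry (T s)

end Pairs

section Dilations

variable {G : Type u} [CommGroup G] [Lattice G] [IsOrderedMonoid G]
variable {H : Type w} [NormedAddCommGroup H] [InnerProductSpace ℂ H] [CompleteSpace H]
variable {K : Type x} [NormedAddCommGroup K] [InnerProductSpace ℂ K] [CompleteSpace K]

/-- The compression `P_H X|_H` to `H` of an operator `X` on `K`, where `H` is regarded as a subspace
of `K` by means of the linear isometry `ι`. -/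
noncomputable def compression (ι : H →ₗᵢ[ℂ] K) (X : K →L[ℂ] K) : H →L[ℂ] H :=
  ContinuousLinearMap.adjoint ι.toContinuousLinearMap ∘L X ∘L ι.toContinuousLinearMap

/-- `V` is an isometric representation of `P` on `K ⊇ H` with `P_H V(p)|_H = T(p)` for all `p`, and it
is minimal: the vectors `V(p) h` with `p ∈ P` and `h ∈ H` span a dense subspace of `K`. -/
structure IsMinimalIsometricDilation (T : Submonoid.oneLE G →* (H →L[ℂ] H))
    (ι : H →ₗᵢ[ℂ] K) (V : Submonoid.oneLE G →* (K →L[ℂ] K)) : Prop where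
  isometric : ∀ p, Isometry (V p)
  dilation : ∀ p, compression ι (V p) = T p
  minimal : (Submodule.span ℂ {k : K | ∃ p h, k = V p (ι h)}).topologicalClosure = ⊤

/-- The dilation `V` of `T` is regular: `P_H V(p)* V(q)|_H = T(p)* T(q)` whenever `p ∧ q = e`. -/
def IsRegularDilation (T : Submonoid.oneLE G →* (H →L[ℂ] H))
    (ι : H →ₗᵢ[ℂ] K) (V : Submonoid.oneLE G →* (K →L[ℂ] K)) : Prop :=
  ∀ p q : Submonoid.oneLE G, (p : G) ⊓ (q : G) = 1 →
    compression ι (star (V p) * V q) = star (T p) * T q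

end Dilations

/-! Everything is governed by the kernel `regularKernel T p q` = T((p/q)₊)* T((q/p)₊). If it is
positive semidefinite, its reproducing kernel space carries the dilation: the kernel is invariant
under a common left factor, so shifts are isometric. Conversely, every regular minimal dilation has
this Gram kernel (`IsRegularDilation.inner_eq`).

Positivity (`posSemidef_regularKernel`): on a finite sublattice, a triangular system with solution D
turns the kernel into a sum of terms L* D L. Inclusion–exclusion identifies each D with a Brehmer
defect of pairwise coprime elements, which Nica-covariance makes a product of commuting positive
operators.

The representation must be ρ(a) V(p) h = V(p) π(α_p(a)) h. Covariance intertwines it with the kernel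
(`IsCovariantPair.regularKernel_mul`), and a C*-norm iteration gives boundedness
(`TotalFamily.exists_starAlgHom`). Nica-covariance of V follows by computing V(t)* on the vectors
V(p) h. -/

/-! ### Coprime parts and finite sublattices in lattice ordered abelian groups. -/

section LatticeOrderedGroup

variable {G : Type u} [CommGroup G] [Lattice G] [IsOrderedMonoid G]

/-- The positive part of an element of a lattice ordered group, as an element of the positive
cone. -/
def toOneLE (g : G) : Submonoid.oneLE G := ⟨g ⊔ 1, le_sup_right⟩

lemma coe_toOneLE (g : G) : (toOneLE g : G) = g ⊔ 1 := rfl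

lemma coe_toOneLE_of_one_le {g : G} (hg : 1 ≤ g) : (toOneLE g : G) = g := sup_eq_left.2 hg

lemma toOneLE_coe (p : Submonoid.oneLE G) : toOneLE (p : G) = p :=
  Subtype.ext (coe_toOneLE_of_one_le p.2)

lemma toOneLE_of_le_one {g : G} (hg : g ≤ 1) : toOneLE g = 1 := Subtype.ext (sup_eq_right.2 hg)

lemma toOneLE_mul {g h : G} (hg : 1 ≤ g) (hh : 1 ≤ h) :
    toOneLE (g * h) = toOneLE g * toOneLE h := by
  ext
  rw [Submonoid.coe_mul, coe_toOneLE_of_one_le hg, coe_toOneLE_of_one_le hh,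
    coe_toOneLE_of_one_le (one_le_mul hg hh)]

lemma toOneLE_div_mul {a b c : G} (hab : a ≤ b) (hbc : b ≤ c) :
    toOneLE (b / a) * toOneLE (c / b) = toOneLE (c / a) := by
  rw [← toOneLE_mul (one_le_div'.2 hab) (one_le_div'.2 hbc)]
  congr 1
  rw [mul_comm, div_mul_div_cancel]

lemma toOneLE_inf_toOneLE_inv (g : G) : (toOneLE g : G) ⊓ toOneLE g⁻¹ = 1 :=
  oneLePart_inf_leOnePart_eq_one g

lemma toOneLE_div_eq (p q : G) : toOneLE (p / q) = toOneLE (p / (p ⊓ q)) := by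
  ext
  rw [coe_toOneLE_of_one_le (one_le_div'.2 inf_le_left), div_inf, div_self', coe_toOneLE, sup_comm]

/-- The common factor is `p ⊓ q`; the cofactors are coprime by `toOneLE_inf_toOneLE_inv`, which
reduces general pairs to coprime ones. -/
lemma exists_mul_toOneLE_div (p q : Submonoid.oneLE G) :
    ∃ r : Submonoid.oneLE G, r * toOneLE ((p : G) / q) = p ∧ r * toOneLE ((q : G) / p) = q := by
  refine ⟨⟨(p : G) ⊓ q, le_inf p.2 q.2⟩, Subtype.ext ?_, Subtype.ext ?_⟩
  · rw [toOneLE_div_eq, Submonoid.coe_mul, coe_toOneLE_of_one_le (one_le_div'.2 inf_le_left)]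
    simp
  · rw [toOneLE_div_eq, inf_comm (q : G), Submonoid.coe_mul,
      coe_toOneLE_of_one_le (one_le_div'.2 inf_le_right)]
    simp

/-- Every finite subset of a lattice ordered abelian group lies in a finite sublattice. -/
lemma exists_finset_sublattice (F : Finset G) :
    ∃ S : Finset G, F ⊆ S ∧ (∀ a ∈ S, ∀ b ∈ S, a ⊓ b ∈ S) ∧ (∀ a ∈ S, ∀ b ∈ S, a ⊔ b ∈ S) := by
  -- Distributivity is what makes the generated sublattice finite.
  let _ : DistribLattice G := CommGroup.toDistribLattice G
  have hfin : (latticeClosure (F : Set G)).Finite := F.finite_toSet.latticeClosure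
  have hsub := isSublattice_latticeClosure (s := (F : Set G))
  refine ⟨hfin.toFinset, fun a ha => ?_, fun a ha b hb => ?_, fun a ha b hb => ?_⟩
  · rw [Set.Finite.mem_toFinset]
    exact subset_latticeClosure ha
  · rw [Set.Finite.mem_toFinset] at *
    exact hsub.infClosed ha hb
  · rw [Set.Finite.mem_toFinset] at *
    exact hsub.supClosed ha hb

lemma inf_mul_eq_one_of_inf_eq_one {a b c : G} (hc : 1 ≤ c) (h : a ⊓ b = 1) :
    a ⊓ (b * c) = a ⊓ c := by
  have ha : 1 ≤ a := h ▸ inf_le_left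
  have hb : 1 ≤ b := h ▸ inf_le_right
  refine le_antisymm (le_inf inf_le_left ?_) (inf_le_inf_left a (le_mul_of_one_le_left' hb))
  calc a ⊓ b * c ≤ (a * c) ⊓ (b * c) := inf_le_inf_right _ (le_mul_of_one_le_right' hc)
    _ = c := by rw [← inf_mul, h, one_mul]

end LatticeOrderedGroup

/-! ### Brehmer defects and positivity of the regular kernel. -/

section Positivity

open ContinuousLinearMap
open scoped InnerProductSpace

variable {G : Type u} [CommGroup G] [Lattice G] [IsOrderedMonoid G]
variable {H : Type w} [NormedAddCommGroup H] [InnerProductSpace ℂ H] [CompleteSpace H]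

/-- The Brehmer defect `∏ (1 - T(x)* T(x))` of a list of elements of the positive cone, written
as an alternating sum. -/
noncomputable def brehmerDefect (T : Submonoid.oneLE G →* (H →L[ℂ] H)) :
    List (Submonoid.oneLE G) → (H →L[ℂ] H)
  | [] => 1
  | x :: X => brehmerDefect T X - star (T x) * brehmerDefect T X * T x

lemma IsNicaCovariant.commute_brehmerDefect {T : Submonoid.oneLE G →* (H →L[ℂ] H)}
    (hT : IsNicaCovariant T) {y : Submonoid.oneLE G} {X : List (Submonoid.oneLE G)}
    (hX : ∀ x ∈ X, (y : G) ⊓ x = 1) : Commute (T y) (brehmerDefect T X) := by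
  induction X with
  | nil => exact Commute.one_right _
  | cons x X ih =>
    have hX' := ih fun z hz => hX z (List.mem_cons_of_mem _ hz)
    have hyx : Commute (T y) (T x) := (Commute.all y x).map T
    exact hX'.sub_right
      ((Commute.mul_right (hT y x (hX x List.mem_cons_self)) hX').mul_right hyx)

/-- Coprimality lets T(x) and T(x)* commute with the defect of the tail, so each step multiplies it
by the commuting positive operator 1 - T(x)*T(x). -/
lemma brehmerDefect_nonneg {T : Submonoid.oneLE G →* (H →L[ℂ] H)} (hT : IsNicaCovariant T)
    (hc : ∀ p, ‖T p‖ ≤ 1) {X : List (Submonoid.oneLE G)}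
    (hX : X.Pairwise fun x y : Submonoid.oneLE G => (x : G) ⊓ y = 1) : 0 ≤ brehmerDefect T X := by
  induction X with
  | nil => exact zero_le_one
  | cons x X ih =>
    obtain ⟨hx, hX⟩ := List.pairwise_cons.1 hX
    have h0 := ih hX
    have hcomm : Commute (T x) (brehmerDefect T X) := hT.commute_brehmerDefect hx
    have hstar : Commute (star (T x)) (brehmerDefect T X) := by
      have := hcomm.star_star
      rwa [h0.isSelfAdjoint.star_eq] at this
    have h1 : 0 ≤ 1 - star (T x) * T x := by
      rw [sub_nonneg, ← CStarAlgebra.norm_le_one_iff_of_nonneg _ (star_mul_self_nonneg _),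
        CStarRing.norm_star_mul_self]
      exact mul_le_one₀ (hc x) (norm_nonneg _) (hc x)
    have h2 : brehmerDefect T (x :: X) = brehmerDefect T X * (1 - star (T x) * T x) := by
      rw [brehmerDefect, hstar.eq, mul_sub, mul_one, mul_assoc]
    rw [h2]
    exact Commute.mul_nonneg h0 h1 ((Commute.one_right _).sub_right
      (hstar.symm.mul_right hcomm.symm))

/-- On a finite partially ordered set, a system of equations `∑_{r ≤ m} f m r (D r) = c` that
is unitriangular can be solved for `D`. -/
lemma exists_triangular_solution {α : Type*} [PartialOrder α] [DecidableEq α] [DecidableLE α]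
    {M : Type*} [AddCommGroup M] (S : Finset α) (f : α → α → M → M) (hf : ∀ m x, f m m x = x)
    (c : M) : ∃ D : α → M, ∀ m ∈ S, ∑ r ∈ S with r ≤ m, f m r (D r) = c := by
  induction S using Finset.strongInduction with
  | H S ih =>
    rcases S.eq_empty_or_nonempty with rfl | hS
    · exact ⟨fun _ => 0, by simp⟩
    -- A maximal `a` enters no equation but its own, which can therefore be solved last.
    obtain ⟨a, ha⟩ := S.exists_maximal hS
    obtain ⟨D, hD⟩ := ih _ (Finset.erase_ssubset ha.prop)
    have hne : ∀ m ∈ S, m ≠ a → ¬ a ≤ m := fun m hm hma ham =>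
      hma (ha.eq_of_le hm ham).symm
    refine ⟨Function.update D a (c - ∑ r ∈ S.erase a with r ≤ a, f a r (D r)), fun m hm => ?_⟩
    rcases eq_or_ne m a with rfl | hma
    · rw [← Finset.insert_erase hm, Finset.filter_insert, if_pos le_rfl,
        Finset.sum_insert (by simp), Function.update_self, hf]
      rw [Finset.erase_insert (Finset.notMem_erase _ _)]
      rw [sub_add_eq_add_sub, add_sub_assoc, sub_eq_zero_of_eq, add_zero]
      refine Finset.sum_congr rfl fun r hr => ?_
      rw [Function.update_of_ne]
      exact Finset.ne_of_mem_erase (Finset.mem_filter.1 hr).1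
    · rw [← hD m (Finset.mem_erase.2 ⟨hma, hm⟩), ← Finset.insert_erase ha.prop,
        Finset.filter_insert, if_neg (hne m hm hma),
        Finset.erase_insert (Finset.notMem_erase _ _)]
      refine Finset.sum_congr rfl fun r hr => ?_
      rw [Function.update_of_ne]
      exact Finset.ne_of_mem_erase (Finset.mem_filter.1 hr).1

open scoped Classical in
/-- Inclusion–exclusion for the solution `D` of the triangular system attached to `T`. -/
lemma sum_filter_eq_brehmerDefect (T : Submonoid.oneLE G →* (H →L[ℂ] H)) {S : Finset G}
    (hinf : ∀ a ∈ S, ∀ b ∈ S, a ⊓ b ∈ S) {D : G → (H →L[ℂ] H)}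
    (hD : ∀ m ∈ S, ∑ r ∈ S with r ≤ m,
      star (T (toOneLE (m / r))) * D r * T (toOneLE (m / r)) = 1)
    {X : List (Submonoid.oneLE G)} (hX : X.Pairwise fun x y : Submonoid.oneLE G => (x : G) ⊓ y = 1) {m : G}
    (hm : m ∈ S) (hmX : ∀ x ∈ X, m / (x : G) ∈ S) :
    ∑ r ∈ S with r ≤ m ∧ ∀ x ∈ X, ¬ r ≤ m / (x : G),
      star (T (toOneLE (m / r))) * D r * T (toOneLE (m / r)) = brehmerDefect T X := by
  induction X generalizing m with
  | nil => simpa [brehmerDefect] using hD m hm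
  | cons x X ih =>
    obtain ⟨hx, hX⟩ := List.pairwise_cons.1 hX
    have hcm : m / (x : G) ≤ m := div_le_self_iff m |>.2 x.2
    have hc : m / (x : G) ∈ S := hmX x List.mem_cons_self
    -- Coprime elements have their product as join; hence these quotients stay in `S`.
    have hcX : ∀ y ∈ X, m / (x : G) / y = m / x ⊓ m / y := fun y hy => by
      have h := inf_mul_sup (x : G) y
      rw [hx y hy, one_mul] at h
      rw [← div_sup, h, div_div]
    have hmX' : ∀ y ∈ X, m / (y : G) ∈ S := fun y hy => hmX y (List.mem_cons_of_mem _ hy)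
    have h1 := ih hX hm hmX'
    have h2 := ih hX hc fun y hy => hcX y hy ▸ hinf _ hc _ (hmX' y hy)
    rw [brehmerDefect, eq_sub_iff_add_eq]
    nth_rw 1 [← h2]
    -- Split by whether r ≤ m/x: the indices below m/x give the sum for `X` at m/x, conjugated by
    -- T(x).
    rw [← h1, Finset.mul_sum, Finset.sum_mul,
      ← Finset.sum_filter_add_sum_filter_not (S.filter fun r => r ≤ m ∧ ∀ y ∈ X, ¬ r ≤ m / (y : G))
        (fun r => ¬ r ≤ m / (x : G))]
    congr 1
    · refine Finset.sum_congr ?_ fun _ _ => rfl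
      ext r
      simp only [Finset.mem_filter, List.forall_mem_cons]
      tauto
    · refine Finset.sum_congr ?_ fun r hr => ?_
      · ext r
        simp only [Finset.mem_filter, not_not]
        constructor
        · rintro ⟨hr, hrc, hrX⟩
          exact ⟨⟨hr, hrc.trans hcm, fun y hy h => hrX y hy (hcX y hy ▸ le_inf hrc h)⟩, hrc⟩
        · rintro ⟨⟨hr, -, hrX⟩, hrc⟩
          exact ⟨hr, hrc, fun y hy h => hrX y hy ((hcX y hy ▸ h).trans inf_le_right)⟩
      · have hrc := not_not.1 (Finset.mem_filter.1 hr).2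
        have : toOneLE (m / r) = toOneLE (m / x / r) * x := by
          rw [← toOneLE_div_mul hrc hcm, div_div_cancel, toOneLE_coe]
        rw [this, map_mul, star_mul]
        simp only [mul_assoc]

-- Take the quotients m/c for c maximal among the elements of `S` strictly below m. Two distinct
-- such c have join m, so the quotients are coprime; every r < m in `S` lies below some c, so
-- inclusion–exclusion leaves only D m.
open scoped Classical in
lemma triangular_solution_nonneg {T : Submonoid.oneLE G →* (H →L[ℂ] H)}
    (hT : IsNicaCovariant T) (hc : ∀ p, ‖T p‖ ≤ 1) {S : Finset G}
    (hinf : ∀ a ∈ S, ∀ b ∈ S, a ⊓ b ∈ S) (hsup : ∀ a ∈ S, ∀ b ∈ S, a ⊔ b ∈ S)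
    {D : G → (H →L[ℂ] H)}
    (hD : ∀ m ∈ S, ∑ r ∈ S with r ≤ m,
      star (T (toOneLE (m / r))) * D r * T (toOneLE (m / r)) = 1) {m : G} (hm : m ∈ S) :
    0 ≤ D m := by
  set B : Finset G := S.filter (· < m)
  set C : Finset G := B.filter fun c => ∀ b ∈ B, c ≤ b → b = c
  set X : List (Submonoid.oneLE G) := C.toList.map fun c => toOneLE (m / c)
  have hCm : ∀ c ∈ C, c < m := fun c hc => (Finset.mem_filter.1 (Finset.mem_filter.1 hc).1).2
  have hCS : ∀ c ∈ C, c ∈ S := fun c hc => (Finset.mem_filter.1 (Finset.mem_filter.1 hc).1).1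
  have hcoe : ∀ c ∈ C, (toOneLE (m / c) : G) = m / c := fun c hc =>
    coe_toOneLE_of_one_le (one_le_div'.2 (hCm c hc).le)
  have hX : X.Pairwise fun x y : Submonoid.oneLE G => (x : G) ⊓ y = 1 := by
    rw [List.pairwise_map]
    refine C.nodup_toList.imp_of_mem fun {c d} hc hd hcd => ?_
    rw [Finset.mem_toList] at hc hd
    rw [hcoe c hc, hcoe d hd, ← div_sup, div_eq_one]
    by_contra hne
    have hB : c ⊔ d ∈ B := Finset.mem_filter.2 ⟨hsup c (hCS c hc) d (hCS d hd),
      lt_of_le_of_ne (sup_le (hCm c hc).le (hCm d hd).le) (Ne.symm hne)⟩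
    exact hcd (((Finset.mem_filter.1 hc).2 _ hB le_sup_left).symm.trans
      ((Finset.mem_filter.1 hd).2 _ hB le_sup_right))
  have hmem : ∀ x ∈ X, ∃ c ∈ C, m / (x : G) = c := fun x hx => by
    obtain ⟨c, hc, rfl⟩ := List.mem_map.1 hx
    rw [Finset.mem_toList] at hc
    exact ⟨c, hc, by rw [hcoe c hc, div_div_cancel]⟩
  have key := sum_filter_eq_brehmerDefect T hinf hD hX hm fun x hx => by
    obtain ⟨c, hc, h⟩ := hmem x hx
    exact h ▸ hCS c hc
  have hfilter : (S.filter fun r => r ≤ m ∧ ∀ x ∈ X, ¬ r ≤ m / (x : G)) = {m} := by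
    ext r
    rw [Finset.mem_filter, Finset.mem_singleton]
    constructor
    · rintro ⟨hr, hrm, hrX⟩
      by_contra hne
      have hrB : r ∈ B := Finset.mem_filter.2 ⟨hr, lt_of_le_of_ne hrm hne⟩
      obtain ⟨c, hrc, hcmax⟩ := B.exists_le_maximal hrB
      have hcC : c ∈ C := Finset.mem_filter.2 ⟨hcmax.prop, fun b hb hcb =>
        (hcmax.eq_of_le hb hcb).symm⟩
      refine hrX (toOneLE (m / c)) (List.mem_map.2 ⟨c, Finset.mem_toList.2 hcC, rfl⟩) ?_
      rwa [hcoe c hcC, div_div_cancel]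
    · rintro rfl
      refine ⟨hm, le_rfl, fun x hx h => ?_⟩
      obtain ⟨c, hc, hcx⟩ := hmem x hx
      exact (hCm c hc).not_ge (hcx ▸ h)
  rw [hfilter, Finset.sum_singleton, div_self', toOneLE_of_le_one le_rfl, map_one, star_one,
    one_mul, mul_one] at key
  exact key ▸ brehmerDefect_nonneg hT hc hX

/-- The kernel `(p, q) ↦ T((p⁻¹q)₋)* T((p⁻¹q)₊)` of a representation of the positive cone. -/
noncomputable def regularKernel (T : Submonoid.oneLE G →* (H →L[ℂ] H)) :
    Matrix (Submonoid.oneLE G) (Submonoid.oneLE G) (H →L[ℂ] H) :=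
  .of fun p q => star (T (toOneLE ((p : G) / q))) * T (toOneLE ((q : G) / p))

lemma regularKernel_apply (T : Submonoid.oneLE G →* (H →L[ℂ] H)) (p q : Submonoid.oneLE G) :
    regularKernel T p q = star (T (toOneLE ((p : G) / q))) * T (toOneLE ((q : G) / p)) := rfl

lemma star_regularKernel (T : Submonoid.oneLE G →* (H →L[ℂ] H)) (p q : Submonoid.oneLE G) :
    star (regularKernel T p q) = regularKernel T q p := by
  simp [regularKernel_apply]

lemma regularKernel_mul_left (T : Submonoid.oneLE G →* (H →L[ℂ] H)) (s p q : Submonoid.oneLE G) :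
    regularKernel T (s * p) (s * q) = regularKernel T p q := by
  simp [regularKernel_apply]

lemma regularKernel_of_inf_eq_one (T : Submonoid.oneLE G →* (H →L[ℂ] H))
    {p q : Submonoid.oneLE G} (h : (p : G) ⊓ q = 1) :
    regularKernel T p q = star (T p) * T q := by
  rw [regularKernel_apply, toOneLE_div_eq, toOneLE_div_eq (q : G), inf_comm (q : G), h, div_one, div_one,
    toOneLE_coe, toOneLE_coe]

lemma regularKernel_one_left (T : Submonoid.oneLE G →* (H →L[ℂ] H)) (q : Submonoid.oneLE G) :
    regularKernel T 1 q = T q := by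
  rw [regularKernel_of_inf_eq_one T (inf_eq_left.2 q.2), map_one, star_one, one_mul]

lemma regularKernel_self (T : Submonoid.oneLE G →* (H →L[ℂ] H)) (p : Submonoid.oneLE G) :
    regularKernel T p p = 1 := by
  simp [regularKernel_apply, toOneLE_of_le_one]

-- Insert the equation at `p ⊓ q` between the two factors of the kernel and use that r ≤ p ⊓ q iff r
-- ≤ p and r ≤ q.
open scoped Classical in
lemma regularKernel_eq_sum (T : Submonoid.oneLE G →* (H →L[ℂ] H)) {S : Finset G}
    {D : G → (H →L[ℂ] H)}
    (hD : ∀ m ∈ S, ∑ r ∈ S with r ≤ m,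
      star (T (toOneLE (m / r))) * D r * T (toOneLE (m / r)) = 1) {p q : Submonoid.oneLE G}
    (hpq : (p : G) ⊓ q ∈ S) :
    regularKernel T p q = ∑ r ∈ S, (if r ≤ (p : G) then star (T (toOneLE ((p : G) / r))) else 0) *
      D r * (if r ≤ (q : G) then T (toOneLE ((q : G) / r)) else 0) := by
  have h1 : ∀ r ∈ S.filter (· ≤ (p : G) ⊓ q), star (T (toOneLE ((p : G) / q))) *
      (star (T (toOneLE (((p : G) ⊓ q) / r))) * D r * T (toOneLE (((p : G) ⊓ q) / r))) *
      T (toOneLE ((q : G) / p)) =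
      star (T (toOneLE ((p : G) / r))) * D r * T (toOneLE ((q : G) / r)) := fun r hr => by
    have hr := (Finset.mem_filter.1 hr).2
    rw [← toOneLE_div_mul hr inf_le_left, ← toOneLE_div_mul hr inf_le_right, map_mul, map_mul,
      star_mul, toOneLE_div_eq (p : G) q, toOneLE_div_eq (q : G) p, inf_comm (q : G)]
    simp only [mul_assoc]
  rw [regularKernel_apply, ← mul_one (star _), ← hD _ hpq, Finset.mul_sum, Finset.sum_mul,
    Finset.sum_congr rfl h1, Finset.sum_filter]
  refine Finset.sum_congr rfl fun r _ => ?_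
  by_cases hp : r ≤ (p : G) <;> by_cases hq : r ≤ (q : G) <;> simp [hp, hq]

/-- The kernel of a Nica-covariant contractive representation is positive semidefinite. -/
theorem posSemidef_regularKernel {T : Submonoid.oneLE G →* (H →L[ℂ] H)}
    (hT : IsNicaCovariant T) (hc : ∀ p, ‖T p‖ ≤ 1) : (regularKernel T).PosSemidef := by
  classical
  have htfae := (RKHS.posSemidef_tfae (K := regularKernel T)).out 0 2
  refine htfae.2 ⟨?_, fun v => ?_⟩
  · ext1 p q
    exact star_regularKernel T q p
  -- Meets supply the equations that expand the kernel; joins are also needed for D ≥ 0.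
  obtain ⟨S, hS, hinf, hsup⟩ := exists_finset_sublattice (v.support.image Subtype.val)
  obtain ⟨D, hD⟩ := exists_triangular_solution S
    (fun m r x => star (T (toOneLE (m / r))) * x * T (toOneLE (m / r)))
    (fun m x => by simp [toOneLE_of_le_one]) 1
  have hmem : ∀ p ∈ v.support, (p : G) ∈ S := fun p hp => hS (Finset.mem_image_of_mem _ hp)
  set L : G → Submonoid.oneLE G → (H →L[ℂ] H) := fun r p =>
    if r ≤ (p : G) then T (toOneLE ((p : G) / r)) else 0
  have hL : ∀ r p, star (L r p) = if r ≤ (p : G) then star (T (toOneLE ((p : G) / r))) else 0 :=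
    fun r p => by simp only [L]; split_ifs <;> simp
  have hsum : (v.sum fun p h => v.sum fun q k => ⟪regularKernel T q p h, k⟫_ℂ) =
      ∑ r ∈ S, ⟪D r (∑ p ∈ v.support, L r p (v p)), ∑ p ∈ v.support, L r p (v p)⟫_ℂ := by
    have h1 : ∀ p ∈ v.support, ∀ q ∈ v.support, ⟪regularKernel T q p (v p), v q⟫_ℂ =
        ∑ r ∈ S, ⟪D r (L r p (v p)), L r q (v q)⟫_ℂ := fun p hp q hq => by
      rw [regularKernel_eq_sum T hD (hinf _ (hmem q hq) _ (hmem p hp)), sum_apply, sum_inner]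
      refine Finset.sum_congr rfl fun r _ => ?_
      rw [← hL, star_eq_adjoint]
      exact adjoint_inner_left _ _ _
    simp only [Finsupp.sum]
    rw [Finset.sum_congr rfl fun p hp => Finset.sum_congr rfl fun q hq => h1 p hp q hq]
    simp only [map_sum, sum_inner, inner_sum]
    rw [Finset.sum_congr rfl fun p _ => Finset.sum_comm, Finset.sum_comm]
    exact Finset.sum_congr rfl fun r _ => Finset.sum_comm
  rw [hsum, map_sum]
  refine Finset.sum_nonneg fun r hr => ?_
  exact ((nonneg_iff_isPositive _).1
    (triangular_solution_nonneg hT hc hinf hsup hD hr)).re_inner_nonneg_left _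

end Positivity

/-! ### Operators determined on a total family by its Gram kernel. -/

section DenseFamilies

open ContinuousLinearMap
open scoped InnerProductSpace

variable {X : Type*}
variable {H : Type*} [NormedAddCommGroup H] [InnerProductSpace ℂ H]
variable {E : Type*} [NormedAddCommGroup E] [InnerProductSpace ℂ E]
variable {F : Type*} [NormedAddCommGroup F] [InnerProductSpace ℂ F]

/-- The ranges of the operators `B x` together span a dense subspace. -/
def TotalFamily (B : X → H →L[ℂ] E) : Prop :=
  (Submodule.span ℂ {k : E | ∃ x h, k = B x h}).topologicalClosure = ⊤

/-- The linear map `∑ x, δ_x ⊗ h_x ↦ ∑ x, B x h_x`. -/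
noncomputable def synthesis (B : X → H →L[ℂ] E) : (X →₀ H) →ₗ[ℂ] E :=
  Finsupp.lsum ℂ fun x => (B x).toLinearMap

lemma synthesis_apply (B : X → H →L[ℂ] E) (v : X →₀ H) :
    synthesis B v = v.sum fun x h => B x h := rfl

lemma synthesis_single (B : X → H →L[ℂ] E) (x : X) (h : H) :
    synthesis B (Finsupp.single x h) = B x h := by
  simp [synthesis]

namespace TotalFamily

variable {B : X → H →L[ℂ] E}

lemma denseRange_synthesis (hB : TotalFamily B) : DenseRange (synthesis B) := by
  have hle : Submodule.span ℂ {k : E | ∃ x h, k = B x h} ≤ LinearMap.range (synthesis B) := by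
    rw [Submodule.span_le]
    rintro _ ⟨x, h, rfl⟩
    exact ⟨Finsupp.single x h, synthesis_single B x h⟩
  exact (Submodule.dense_iff_topologicalClosure_eq_top.2 hB).mono hle

lemma clm_ext (hB : TotalFamily B) {f g : E →L[ℂ] F} (h : ∀ x k, f (B x k) = g (B x k)) :
    f = g := by
  refine ContinuousLinearMap.ext_on (Submodule.dense_iff_topologicalClosure_eq_top.2 hB) ?_
  rintro _ ⟨x, k, rfl⟩
  exact h x k

lemma ext_inner (hB : TotalFamily B) {u v : E} (h : ∀ x k, ⟪u, B x k⟫_ℂ = ⟪v, B x k⟫_ℂ) :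
    u = v := by
  have := hB.clm_ext (f := innerSL ℂ u) (g := innerSL ℂ v) (by simpa using h)
  exact ext_inner_right ℂ fun w => by simpa using congr($this w)

lemma inner_synthesis (B : X → H →L[ℂ] E) (v w : X →₀ H) :
    ⟪synthesis B v, synthesis B w⟫_ℂ = v.sum fun x h => w.sum fun y k => ⟪B x h, B y k⟫_ℂ := by
  simp only [synthesis_apply, Finsupp.sum, sum_inner, inner_sum]
  exact Finset.sum_comm

/-- Equal Gram kernels give equal norms of finite combinations, so the map is well defined and
isometric on a dense subspace. -/
lemma exists_isometry [CompleteSpace F] (hB : TotalFamily B) (C : X → H →L[ℂ] F)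
    (hBC : ∀ x y h k, ⟪C x h, C y k⟫_ℂ = ⟪B x h, B y k⟫_ℂ) :
    ∃ V : E →L[ℂ] F, Isometry V ∧ ∀ x h, V (B x h) = C x h := by
  have hnorm : ∀ v, ‖synthesis C v‖ = ‖synthesis B v‖ := fun v => by
    rw [@norm_eq_sqrt_re_inner ℂ, @norm_eq_sqrt_re_inner ℂ _ _ _ _ (synthesis B v),
      inner_synthesis, inner_synthesis]
    simp only [hBC]
  have hd := hB.denseRange_synthesis
  have hV : ∀ v, (synthesis C).extendOfNorm (synthesis B) (synthesis B v) = synthesis C v :=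
    LinearMap.extendOfNorm_eq hd ⟨1, fun v => by rw [one_mul, hnorm]⟩
  refine ⟨(synthesis C).extendOfNorm (synthesis B), ?_, fun x h => ?_⟩
  · refine AddMonoidHomClass.isometry_of_norm _ fun u => ?_
    refine hd.induction_on (p := fun u => ‖(synthesis C).extendOfNorm (synthesis B) u‖ = ‖u‖) u
      (isClosed_eq (by fun_prop) (by fun_prop)) fun v => ?_
    rw [hV, hnorm]
  · rw [← synthesis_single B, hV, synthesis_single]

end TotalFamily

lemma le_of_forall_pow_two_pow_mul_le {y z u C : ℝ} (hz : 0 ≤ z) (hu : 0 < u)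
    (h : ∀ n : ℕ, y ^ 2 ^ n * u ≤ C * z ^ 2 ^ n) : y ≤ z := by
  by_contra! hlt
  rcases hz.eq_or_lt with rfl | hz
  · have := h 0
    simp only [pow_zero, pow_one, mul_zero] at this
    exact this.not_gt (mul_pos hlt hu)
  · obtain ⟨m, hm⟩ := pow_unbounded_of_one_lt (C / u) ((one_lt_div hz).2 hlt)
    have h1 : (y / z) ^ m ≤ (y / z) ^ 2 ^ m :=
      pow_le_pow_right₀ ((one_lt_div hz).2 hlt).le m.lt_two_pow_self.le
    have h2 : (y / z) ^ 2 ^ m ≤ C / u := by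
      rw [div_pow, div_le_div_iff₀ (by positivity) hu]
      exact h m
    exact (hm.trans_le (h1.trans h2)).false

/-- A family of `*`-representations `σ x` that is compatible with the Gram kernel of a total
family `B` induces a `*`-representation on the big space that acts on `B x h` through `σ x`. -/
theorem TotalFamily.exists_starAlgHom {A : Type*} [NonUnitalCStarAlgebra A] [CompleteSpace H]
    [CompleteSpace E] {B : X → H →L[ℂ] E} (hB : TotalFamily B) (σ : X → A →⋆ₙₐ[ℂ] (H →L[ℂ] H))
    (hσ : ∀ a x y h k, ⟪B x (σ x a h), B y k⟫_ℂ = ⟪B x h, B y (σ y (star a) k)⟫_ℂ) :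
    ∃ ρ : A →⋆ₙₐ[ℂ] (E →L[ℂ] E), ∀ a x h, ρ a (B x h) = B x (σ x a h) := by
  set S : A → (X →₀ H) →ₗ[ℂ] E := fun a => synthesis fun x => B x ∘L σ x a
  have hS : ∀ a v, S a v = v.sum fun x h => B x (σ x a h) := fun a v => rfl
  have hinner : ∀ a v, ⟪S a v, S a v⟫_ℂ = ⟪S (star a * a) v, synthesis B v⟫_ℂ := fun a v => by
    rw [hS, hS, synthesis_apply]
    simp only [Finsupp.sum, sum_inner, inner_sum]
    refine Finset.sum_congr rfl fun x _ => Finset.sum_congr rfl fun y _ => ?_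
    rw [map_mul]
    exact ((hσ (star a) y x _ _).trans (by rw [star_star]; rfl)).symm
  have hcs : ∀ a v, ‖S a v‖ ^ 2 ≤ ‖S (star a * a) v‖ * ‖synthesis B v‖ := fun a v => by
    rw [← @inner_self_eq_norm_sq ℂ, hinner]
    exact (RCLike.re_le_norm _).trans (norm_inner_le_norm _ _)
  -- This constant depends on `v`, not just on `synthesis B v`. Iterating `hcs` with the C*-identity
  -- puts it against 2^n-th powers, where it becomes harmless.
  have hcrude : ∀ v : X →₀ H, ∀ a, ‖S a v‖ ≤ (v.sum fun x h => ‖B x‖ * ‖h‖) * ‖a‖ :=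
    fun v a => by
      rw [hS, Finsupp.sum, Finsupp.sum, Finset.sum_mul]
      refine (norm_sum_le _ _).trans (Finset.sum_le_sum fun x _ => ?_)
      calc ‖B x (σ x a (v x))‖ ≤ ‖B x‖ * (‖σ x a‖ * ‖v x‖) :=
            (le_opNorm _ _).trans (by gcongr; exact le_opNorm _ _)
        _ ≤ ‖B x‖ * (‖a‖ * ‖v x‖) := by
            gcongr
            exact NonUnitalStarAlgHom.norm_apply_le _ _
        _ = ‖B x‖ * ‖v x‖ * ‖a‖ := by ring
  have hiter : ∀ v : X →₀ H, ∀ (n : ℕ) (a : A), ‖S a v‖ ^ 2 ^ n * ‖synthesis B v‖ ≤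
      (v.sum fun x h => ‖B x‖ * ‖h‖) * (‖a‖ * ‖synthesis B v‖) ^ 2 ^ n := fun v n => by
    induction n with
    | zero =>
      intro a
      rw [pow_zero, pow_one, pow_one, ← mul_assoc]
      gcongr
      exact hcrude v a
    | succ n ih =>
      intro a
      calc ‖S a v‖ ^ 2 ^ (n + 1) * ‖synthesis B v‖
          = (‖S a v‖ ^ 2) ^ 2 ^ n * ‖synthesis B v‖ := by rw [← pow_mul, pow_succ']
        _ ≤ (‖S (star a * a) v‖ * ‖synthesis B v‖) ^ 2 ^ n * ‖synthesis B v‖ := by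
            gcongr
            exact hcs a v
        _ = ‖S (star a * a) v‖ ^ 2 ^ n * ‖synthesis B v‖ * ‖synthesis B v‖ ^ 2 ^ n := by
            rw [mul_pow]; ring
        _ ≤ (v.sum fun x h => ‖B x‖ * ‖h‖) * (‖star a * a‖ * ‖synthesis B v‖) ^ 2 ^ n *
              ‖synthesis B v‖ ^ 2 ^ n :=
            mul_le_mul_of_nonneg_right (ih _) (by positivity)
        _ = _ := by
            rw [CStarRing.norm_star_mul_self, mul_assoc, ← mul_pow, pow_succ' 2 n, pow_mul]
            congr 2
            ring
  have hbound : ∀ a v, ‖S a v‖ ≤ ‖a‖ * ‖synthesis B v‖ := fun a v => by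
    -- For null vectors the iterated estimate is vacuous, but `hcs` alone suffices.
    rcases (norm_nonneg (synthesis B v)).eq_or_lt with h0 | h0
    · have := hcs a v
      rw [← h0, mul_zero] at this
      rw [← h0, mul_zero]
      exact (pow_eq_zero_iff two_ne_zero).1 (this.antisymm (sq_nonneg _)) |>.le
    · exact le_of_forall_pow_two_pow_mul_le (by positivity) h0
        fun n => hiter v n a
  set ρ : A → E →L[ℂ] E := fun a => (S a).extendOfNorm (synthesis B)
  have hρ : ∀ a x h, ρ a (B x h) = B x (σ x a h) := fun a x h => by
    have := LinearMap.extendOfNorm_eq hB.denseRange_synthesis ⟨‖a‖, hbound a⟩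
      (Finsupp.single x h)
    rwa [synthesis_single, synthesis_single] at this
  refine ⟨{ toFun := ρ
            map_smul' := fun c a => hB.clm_ext fun x h => ?_
            map_zero' := hB.clm_ext fun x h => ?_
            map_add' := fun a b => hB.clm_ext fun x h => ?_
            map_mul' := fun a b => hB.clm_ext fun x h => ?_
            map_star' := fun a => hB.clm_ext fun x h => ?_ }, hρ⟩
  · simp [hρ]
  · simp [hρ]
  · simp [hρ]
  · simp [hρ]
  · refine hB.ext_inner fun y k => ?_
    rw [hρ, hσ, star_star, star_eq_adjoint, adjoint_inner_left, hρ]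

end DenseFamilies

/-! ### Existence, Gram kernel and Nica-covariance of regular dilations. -/

section RegularDilations

open ContinuousLinearMap
open scoped InnerProductSpace

variable {G : Type u} [CommGroup G] [Lattice G] [IsOrderedMonoid G]
variable {H : Type w} [NormedAddCommGroup H] [InnerProductSpace ℂ H] [CompleteSpace H]

/-- A contractive representation with positive semidefinite kernel has a regular minimal
isometric dilation. -/
theorem exists_regular_dilation {T : Submonoid.oneLE G →* (H →L[ℂ] H)}
    (hT : (regularKernel T).PosSemidef) :
    ∃ (K : Type (max u w)) (_ : NormedAddCommGroup K) (_ : InnerProductSpace ℂ K)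
        (_ : CompleteSpace K) (ι : H →ₗᵢ[ℂ] K) (V : Submonoid.oneLE G →* (K →L[ℂ] K)),
      IsMinimalIsometricDilation T ι V ∧ IsRegularDilation T ι V := by
  have : Fact (regularKernel T).PosSemidef := ⟨hT⟩
  let K := RKHS.OfKernel (regularKernel T)
  let B : Submonoid.oneLE G → H →L[ℂ] K := RKHS.kerFun K
  have hB : TotalFamily B := by
    have := RKHS.kerFun_dense K
    simpa only [TotalFamily, eq_comm] using this
  have hBB : ∀ p q h k, ⟪B p h, B q k⟫_ℂ = ⟪regularKernel T q p h, k⟫_ℂ := fun p q h k => by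
    rw [← RKHS.kernel_inner K, RKHS.OfKernel.kernel_ofKernel]
  have hex : ∀ s : Submonoid.oneLE G, ∃ W : K →L[ℂ] K, Isometry W ∧
      ∀ p h, W (B p h) = B (s * p) h := fun s =>
    hB.exists_isometry (fun p => B (s * p)) fun p q h k => by
      rw [hBB, hBB, regularKernel_mul_left]
  choose W hW hWB using hex
  let V : Submonoid.oneLE G →* (K →L[ℂ] K) :=
    { toFun := W
      map_one' := hB.clm_ext fun p h => by simp [hWB]
      map_mul' := fun s t => hB.clm_ext fun p h => by simp [hWB, mul_assoc] }
  let ι : H →ₗᵢ[ℂ] K :=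
    { toLinearMap := (B 1).toLinearMap
      norm_map' := fun h => by
        have : ⟪B 1 h, B 1 h⟫_ℂ = ⟪h, h⟫_ℂ := by rw [hBB, regularKernel_self, one_apply_eq_self]
        rw [@norm_eq_sqrt_re_inner ℂ, @norm_eq_sqrt_re_inner ℂ _ _ _ _ h]
        exact congr(√(RCLike.re $this)) }
  have hVι : ∀ p h, V p (ι h) = B p h := fun p h => by
    change W p (B 1 h) = B p h
    rw [hWB, mul_one]
  have hcomp : ∀ p q, compression ι (star (V p) * V q) = regularKernel T p q := fun p q => by
    ext h
    refine ext_inner_right ℂ fun k => ?_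
    rw [compression, comp_apply, adjoint_inner_left, comp_apply, mul_apply_eq_comp, star_eq_adjoint,
      adjoint_inner_left]
    change ⟪V q (ι h), V p (ι k)⟫_ℂ = _
    rw [hVι, hVι, hBB]
  refine ⟨K, inferInstance, inferInstance, inferInstance, ι, V, ⟨hW, fun p => ?_, ?_⟩,
    fun p q hpq => ?_⟩
  · rw [← regularKernel_one_left T p, ← hcomp, map_one, star_one, one_mul]
  · simp only [hVι]
    exact hB
  · rw [hcomp, regularKernel_of_inf_eq_one T hpq]

variable {K : Type x} [NormedAddCommGroup K] [InnerProductSpace ℂ K] [CompleteSpace K]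
variable {T : Submonoid.oneLE G →* (H →L[ℂ] H)} {ι : H →ₗᵢ[ℂ] K}
  {V : Submonoid.oneLE G →* (K →L[ℂ] K)}

lemma inner_compression (ι : H →ₗᵢ[ℂ] K) (Y : K →L[ℂ] K) (h k : H) :
    ⟪compression ι Y h, k⟫_ℂ = ⟪Y (ι h), ι k⟫_ℂ := by
  rw [compression, comp_apply, adjoint_inner_left]
  rfl

lemma IsMinimalIsometricDilation.totalFamily (hV : IsMinimalIsometricDilation T ι V) :
    TotalFamily fun p => V p ∘L ι.toContinuousLinearMap := hV.minimal

lemma IsMinimalIsometricDilation.inner_apply_apply (hV : IsMinimalIsometricDilation T ι V)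
    (p : Submonoid.oneLE G) (x y : K) : ⟪V p x, V p y⟫_ℂ = ⟪x, y⟫_ℂ :=
  ((V p).toLinearMap.toLinearIsometry (hV.isometric p)).inner_map_map x y

/-- The Gram kernel of a regular isometric dilation. -/
lemma IsRegularDilation.inner_eq (hreg : IsRegularDilation T ι V)
    (hV : IsMinimalIsometricDilation T ι V) (p q : Submonoid.oneLE G) (h k : H) :
    ⟪V p (ι h), V q (ι k)⟫_ℂ = ⟪regularKernel T q p h, k⟫_ℂ := by
  -- The isometry V(r) drops out, leaving a coprime pair to which regularity applies.
  obtain ⟨r, hp, hq⟩ := exists_mul_toOneLE_div p q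
  set p' := toOneLE ((p : G) / q)
  set q' := toOneLE ((q : G) / p)
  have hpq : (q' : G) ⊓ p' = 1 := by
    have := toOneLE_inf_toOneLE_inv ((q : G) / p)
    rwa [inv_div] at this
  rw [← hp, ← hq, map_mul, map_mul, mul_apply_eq_comp, mul_apply_eq_comp, hV.inner_apply_apply,
    regularKernel_mul_left, regularKernel_of_inf_eq_one T hpq, ← hreg q' p' hpq,
    inner_compression, mul_apply_eq_comp, star_eq_adjoint, adjoint_inner_left]

/-- A factor s coprime to t does not change the meet with t: t ⊓ sp = t ⊓ p. -/
lemma toOneLE_div_mul_left_of_inf_eq_one {s t p : Submonoid.oneLE G} (hst : (s : G) ⊓ t = 1) :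
    toOneLE (((s * p : Submonoid.oneLE G) : G) / t) = s * toOneLE ((p : G) / t) := by
  ext
  rw [toOneLE_div_eq, inf_comm, Submonoid.coe_mul,
    inf_mul_eq_one_of_inf_eq_one p.2 (inf_comm (s : G) t ▸ hst), Submonoid.coe_mul,
    toOneLE_div_eq (p : G), inf_comm (p : G), ← mul_div_assoc',
    coe_toOneLE_of_one_le (one_le_mul s.2 (one_le_div'.2 inf_le_right)),
    coe_toOneLE_of_one_le (one_le_div'.2 inf_le_right)]

lemma toOneLE_div_mul_right_of_inf_eq_one {s t p : Submonoid.oneLE G} (hst : (s : G) ⊓ t = 1) :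
    toOneLE ((t : G) / (s * p : Submonoid.oneLE G)) = toOneLE ((t : G) / p) := by
  rw [toOneLE_div_eq, toOneLE_div_eq (t : G) p, Submonoid.coe_mul,
    inf_mul_eq_one_of_inf_eq_one p.2 (inf_comm (s : G) t ▸ hst)]

/-- The action of `V(t)*` on the vectors `V(p) h`, for coprime `t` and `p`. -/
lemma IsRegularDilation.star_apply_apply (hreg : IsRegularDilation T ι V)
    (hV : IsMinimalIsometricDilation T ι V) (hT : IsNicaCovariant T) {t p : Submonoid.oneLE G}
    (htp : (t : G) ⊓ p = 1) (h : H) :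
    star (V t) (V p (ι h)) = V p (ι (star (T t) h)) := by
  refine hV.totalFamily.ext_inner fun q k => ?_
  have hker : regularKernel T (t * q) p = regularKernel T q p * star (T t) := by
    -- Since (p/q)₊ ≤ p, it is coprime to t, so T(t)* can be moved to the right of T((p/q)₊).
    have htpq : (t : G) ⊓ toOneLE ((p : G) / q) = 1 :=
      le_antisymm (htp ▸ inf_le_inf_left _ (sup_le (div_le_self_iff _ |>.2 q.2) p.2))
        (le_inf t.2 (toOneLE _).2)
    rw [regularKernel_apply, toOneLE_div_mul_left_of_inf_eq_one htp,
      toOneLE_div_mul_right_of_inf_eq_one htp, regularKernel_apply, map_mul, star_mul,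
      mul_assoc, ← hT _ _ (inf_comm (t : G) _ ▸ htpq), mul_assoc]
  change ⟪_, V q (ι k)⟫_ℂ = ⟪_, V q (ι k)⟫_ℂ
  rw [star_eq_adjoint, adjoint_inner_left, ← mul_apply_eq_comp, ← map_mul, hreg.inner_eq hV,
    hreg.inner_eq hV, hker, mul_apply_eq_comp]

lemma IsMinimalIsometricDilation.star_mul_self (hV : IsMinimalIsometricDilation T ι V)
    (p : Submonoid.oneLE G) : star (V p) * V p = 1 := by
  ext x
  refine ext_inner_right ℂ fun y => ?_
  rw [mul_apply_eq_comp, star_eq_adjoint, adjoint_inner_left, hV.inner_apply_apply,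
    one_apply_eq_self]

/-- The action of `V(t)*` on the vectors `V(p) h`. -/
lemma IsRegularDilation.star_apply_apply_eq (hreg : IsRegularDilation T ι V)
    (hV : IsMinimalIsometricDilation T ι V) (hT : IsNicaCovariant T) (t p : Submonoid.oneLE G)
    (h : H) : star (V t) (V p (ι h)) =
      V (toOneLE ((p : G) / t)) (ι (star (T (toOneLE ((t : G) / p))) h)) := by
  obtain ⟨r, hp, ht⟩ := exists_mul_toOneLE_div p t
  have htp : (toOneLE ((t : G) / p) : G) ⊓ toOneLE ((p : G) / t) = 1 := by
    simpa only [inv_div] using toOneLE_inf_toOneLE_inv ((t : G) / p)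
  rw [← hreg.star_apply_apply hV hT htp]
  nth_rw 1 [← hp, ← ht]
  rw [map_mul, map_mul, star_mul, ← mul_apply_eq_comp, mul_assoc, ← mul_assoc (star (V r)),
    hV.star_mul_self, one_mul, mul_apply_eq_comp]

/-- A regular minimal isometric dilation of a Nica-covariant representation is
Nica-covariant. -/
theorem IsRegularDilation.isNicaCovariant (hreg : IsRegularDilation T ι V)
    (hV : IsMinimalIsometricDilation T ι V) (hT : IsNicaCovariant T) : IsNicaCovariant V := by
  refine fun s t hst => hV.totalFamily.clm_ext fun p h => ?_
  change V s (star (V t) (V p (ι h))) = star (V t) ((V s * V p) (ι h))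
  rw [← map_mul, hreg.star_apply_apply_eq hV hT, hreg.star_apply_apply_eq hV hT,
    toOneLE_div_mul_left_of_inf_eq_one hst, toOneLE_div_mul_right_of_inf_eq_one hst, map_mul,
    mul_apply_eq_comp]

end RegularDilations

/-! ### Extending the representation of the algebra to the dilation space. -/

section CovariantPairs

open ContinuousLinearMap
open scoped InnerProductSpace

variable {G : Type u} [CommGroup G] [Lattice G] [IsOrderedMonoid G]
variable {A : Type v} [NonUnitalCStarAlgebra A]
variable {H : Type w} [NormedAddCommGroup H] [InnerProductSpace ℂ H] [CompleteSpace H]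
variable {K : Type x} [NormedAddCommGroup K] [InnerProductSpace ℂ K] [CompleteSpace K]
variable {α : Submonoid.oneLE G →ₙ* (A →⋆ₙₐ[ℂ] A)} {π : A →⋆ₙₐ[ℂ] (H →L[ℂ] H)}
  {T : Submonoid.oneLE G →* (H →L[ℂ] H)} {ι : H →ₗᵢ[ℂ] K} {V : Submonoid.oneLE G →* (K →L[ℂ] K)}

/-- `α 1` need not be the identity, but T(1) = 1 makes the difference invisible to π. -/
lemma IsCovariantPair.apply_one (h : IsCovariantPair α π T) (a : A) : π (α 1 a) = π a := by
  simpa using (h.covariant 1 a).symm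

lemma IsCovariantPair.star_covariant (h : IsCovariantPair α π T) (s : Submonoid.oneLE G) (a : A) :
    star (T s) * π a = π (α s a) * star (T s) := by
  have := congr(star $(h.covariant s (star a)))
  rwa [star_mul, star_mul, ← map_star π, ← map_star π, ← map_star (α s), star_star] at this

/-- With p = rp' and q = rq', covariance strips α_{p'} on passing T(p'), and its adjoint form adds
α_{q'} on passing T(q')*. -/
lemma IsCovariantPair.regularKernel_mul (h : IsCovariantPair α π T) (p q : Submonoid.oneLE G)
    (a : A) : regularKernel T q p * π (α p a) = π (α q a) * regularKernel T q p := by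
  obtain ⟨r, hp, hq⟩ := exists_mul_toOneLE_div p q
  have hαp : α p a = α (toOneLE ((p : G) / q)) (α r a) := by
    conv_lhs => rw [← hp, mul_comm, map_mul]
    rfl
  have hαq : α q a = α (toOneLE ((q : G) / p)) (α r a) := by
    conv_lhs => rw [← hq, mul_comm, map_mul]
    rfl
  rw [regularKernel_apply, hαp, hαq, mul_assoc, ← h.covariant, ← mul_assoc, h.star_covariant,
    mul_assoc]

/-- A covariant pair extends to every regular minimal isometric dilation. -/
theorem IsNicaCovariantPair.exists_extension (h : IsNicaCovariantPair α π T)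
    (hV : IsMinimalIsometricDilation T ι V) (hreg : IsRegularDilation T ι V) :
    ∃ ρ : A →⋆ₙₐ[ℂ] (K →L[ℂ] K), IsIsometricNicaCovariantPair α ρ V ∧
      ∀ a k, ρ a (ι k) = ι (π a k) := by
  -- Covariance and ρ(a)|_H = π(a) force the choice π ∘ α_p on the p-th copy of H.
  obtain ⟨ρ, hρ⟩ := hV.totalFamily.exists_starAlgHom (fun p => π.comp (α p))
    fun a p q k l => by
      change ⟪V p (ι (π (α p a) k)), V q (ι l)⟫_ℂ = ⟪V p (ι k), V q (ι (π (α q (star a)) l))⟫_ℂ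
      rw [hreg.inner_eq hV, hreg.inner_eq hV, ← mul_apply_eq_comp, h.regularKernel_mul,
        mul_apply_eq_comp, map_star, map_star, star_eq_adjoint, adjoint_inner_right]
  replace hρ : ∀ a p k, ρ a (V p (ι k)) = V p (ι (π (α p a) k)) := hρ
  refine ⟨ρ, ⟨⟨⟨fun s => ?_, fun s a => ?_⟩, hreg.isNicaCovariant hV h.nica⟩, hV.isometric⟩,
    fun a k => ?_⟩
  · refine opNorm_le_bound _ zero_le_one fun y => ?_
    rw [one_mul, (hV.isometric s).norm_map_of_map_zero (map_zero _)]
  · refine hV.totalFamily.clm_ext fun p k => ?_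
    change ρ a ((V s * V p) (ι k)) = V s (ρ (α s a) (V p (ι k)))
    rw [← map_mul V, hρ, hρ, mul_comm s p, map_mul α, mul_comm p s, map_mul V]
    rfl
  · have := hρ a 1 k
    rwa [map_one, one_apply_eq_self, one_apply_eq_self, h.apply_one] at this

end CovariantPairs

theorem theorem7p3
    {G : Type u} [CommGroup G] [Lattice G] [IsOrderedMonoid G]
    {A : Type v} [NonUnitalCStarAlgebra A]
    {H : Type w} [NormedAddCommGroup H] [InnerProductSpace ℂ H] [CompleteSpace H]
    (α : Submonoid.oneLE G →ₙ* (A →⋆ₙₐ[ℂ] A))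
    (π : A →⋆ₙₐ[ℂ] (H →L[ℂ] H)) (T : Submonoid.oneLE G →* (H →L[ℂ] H))
    (hπT : IsNicaCovariantPair α π T) :
    (∃ (K : Type (max u w)) (_ : NormedAddCommGroup K) (_ : InnerProductSpace ℂ K)
        (_ : CompleteSpace K) (ι : H →ₗᵢ[ℂ] K) (V : Submonoid.oneLE G →* (K →L[ℂ] K)),
      IsMinimalIsometricDilation T ι V ∧ IsRegularDilation T ι V) ∧
    (∀ (K : Type x) [NormedAddCommGroup K] [InnerProductSpace ℂ K] [CompleteSpace K]
        (ι : H →ₗᵢ[ℂ] K) (V : Submonoid.oneLE G →* (K →L[ℂ] K)),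
      IsMinimalIsometricDilation T ι V → IsRegularDilation T ι V →
      ∃ ρ : A →⋆ₙₐ[ℂ] (K →L[ℂ] K),
        IsIsometricNicaCovariantPair α ρ V ∧
        (∀ a, compression ι (ρ a) = π a) ∧
        (∀ a h, ρ a (ι h) ∈ Set.range ι)) := by
  refine ⟨exists_regular_dilation (posSemidef_regularKernel hπT.nica hπT.contractive), ?_⟩
  intro K _ _ _ ι V hV hreg
  obtain ⟨ρ, hρ, hext⟩ := hπT.exists_extension hV hreg
  refine ⟨ρ, hρ, fun a => ?_, fun a h => ⟨π a h, (hext a h).symm⟩⟩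
  ext h
  refine ext_inner_right ℂ fun k => ?_
  rw [inner_compression, hext, ι.inner_map_map]
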